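/- All graphs are finite and simple. For a graph $G$, let $F(G)$ (the core index of $G$) be the number of connected subgraphs of $G$, where a subgraph is any non-empty set of vertices together with any set of edges of $G$ between them. A graph on $n$ vertices is unicyclic if it is connected and has exactly $n$ edges, and its girth is the length of a shortest cycle. For integers $3\le g<n$, let $U^p_{n,g}$ (the pineapple graph) be the graph on $n$ vertices obtained from the cycle $C_g$ by attaching $n-g$ pendant vertices to a single vertex of the cycle. Let $3\le g<n$. Then $U^p_{n,g}$ is a unicyclic graph on $n$ vertices with girth $g$, and for every unicyclic graph $G$ on $n$ vertices with girth $g$, $$F(G)\le F(U^p_{n,g}),$$ with equality if and only if $G$ is isomorphic to $U^p_{n,g}$. Moreover, $$F(U^p_{n,g})=n+g^2-g+1+(2^{n-g}-1)\left(2g+\binom{g-1}{2}\right).$$ -/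

import Mathlib

/-- The core index `F(G)`: the number of connected subgraphs of `G`. A subgraph is a set of
vertices together with a set of edges of `G` between them (not necessarily induced); connected
subgraphs have at least one vertex. -/
noncomputable def coreIndex {V : Type*} (G : SimpleGraph V) : ℕ :=
  Nat.card {H : G.Subgraph // H.Connected}

/-- A graph on a finite vertex set is unicyclic if it is connected and has as many edges as
vertices. -/
def IsUnicyclic {V : Type*} [Finite V] (G : SimpleGraph V) : Prop :=
  G.Connected ∧ G.edgeSet.ncard = Nat.card V

/-- The pineapple graph on the `n` vertices `0, …, n - 1` with a cycle of length `g`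
(meant for `3 ≤ g < n`): the cycle is `0, 1, …, g - 1, 0`, and each of the remaining `n - g`
vertices `g, …, n - 1` is a pendant vertex adjacent to the cycle vertex `0` only. -/
def pineappleGraph (n g : ℕ) : SimpleGraph (Fin n) :=
  SimpleGraph.fromRel fun i j : Fin n =>
    (i.val + 1 = j.val ∧ j.val < g) ∨
    (i.val = 0 ∧ j.val + 1 = g) ∨
    (i.val = 0 ∧ g ≤ j.val)

/-! Induction on the number `m` of vertices off the cycle. A unicyclic graph with `m > 0` has a
leaf; deleting it leaves a unicyclic graph `H` of the same girth, and `G` is `H` with a leaf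
attached at some `u`.

Write `F_H(A)` for the number of connected subgraphs containing `A`. A connected subgraph of `G`
avoids the leaf, is the leaf alone, or is a connected subgraph of `H` through `u` extended by the
pendant edge. Hence `F(G) = F(H) + F_H(u) + 1`, and it remains to maximize `F_H(u)`.

The same splitting gives `F_G(w) = F_H(w) + F_H({u, w})` for `w` in `H`, at most `2 F_H(w)` with
equality only for `u = w`, while the leaf itself has `F_H(u) + 1 < 2 F_H(u)`. So each leaf at most
doubles the bound, and equality forces every leaf onto `w`: `w` is the centre of a pineapple
(`IsUnicyclic.coreIndexAt_singleton_le`). Equality in `F` then follows from equality in `F_H(u)`.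

The base case is the cycle `C_g`, whose connected subgraphs are `C_g` itself and `g ^ 2` arcs.
Modelling it on `ZMod` describes arcs by inequalities between values of `x - a`. -/

namespace SimpleGraph

variable {V W : Type*}

/-! ### Connected subgraphs and their invariance under isomorphism -/

/-- A subgraph is connected iff it has a vertex and any two of its vertices are joined by a chain
of its edges. -/
lemma Subgraph.connected_iff_reflTransGen {G : SimpleGraph V} {S : G.Subgraph} :
    S.Connected ↔ S.verts.Nonempty ∧
      ∀ a ∈ S.verts, ∀ b ∈ S.verts, Relation.ReflTransGen S.Adj a b := by
  rw [Subgraph.connected_iff, Subgraph.preconnected_iff, and_comm]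
  refine and_congr_right fun _ => ⟨fun h a ha b hb => ?_, fun h => ?_⟩
  · have := (reachable_iff_reflTransGen _ _).1 (h ⟨a, ha⟩ ⟨b, hb⟩)
    exact this.lift (p := S.Adj) Subtype.val fun x y hxy => hxy
  · rintro ⟨a, ha⟩ ⟨b, hb⟩
    have key : ∀ x, Relation.ReflTransGen S.Adj a x →
        ∀ hx : x ∈ S.verts, S.coe.Reachable ⟨a, ha⟩ ⟨x, hx⟩ := by
      intro x hax
      induction hax with
      | refl => exact fun _ => Reachable.refl _
      | tail _ hyz ih =>
        exact fun hz => (ih hyz.fst_mem).trans (Adj.reachable (G := S.coe) hyz)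
    exact key b (h a ha b hb) hb

/-- The connected subgraphs of `G` containing all vertices in `A`. -/
def connectedSubgraphs (G : SimpleGraph V) (A : Set V) : Set G.Subgraph :=
  {S | S.Connected ∧ A ⊆ S.verts}

/-- The number of connected subgraphs of `G` containing all vertices in `A`. -/
noncomputable def coreIndexAt (G : SimpleGraph V) (A : Set V) : ℕ :=
  (G.connectedSubgraphs A).ncard

lemma coreIndex_eq_coreIndexAt (G : SimpleGraph V) : coreIndex G = G.coreIndexAt ∅ := by
  unfold coreIndex coreIndexAt connectedSubgraphs
  rw [← Nat.card_coe_set_eq]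
  simp only [Set.empty_subset, and_true, Set.coe_ofPred]

lemma Subgraph.Connected.map_iso {G : SimpleGraph V} {H : SimpleGraph W} {S : G.Subgraph}
    (hS : S.Connected) (φ : G ≃g H) : (S.map φ.toHom).Connected := by
  rw [connected_iff_reflTransGen] at hS ⊢
  refine ⟨by simpa using hS.1, ?_⟩
  rintro _ ⟨a, ha, rfl⟩ _ ⟨b, hb, rfl⟩
  exact (hS.2 a ha b hb).lift (p := (S.map φ.toHom).Adj) _ fun x y hxy => ⟨x, y, hxy, rfl, rfl⟩

lemma Subgraph.comap_map_iso {G : SimpleGraph V} {H : SimpleGraph W} (φ : G ≃g H)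
    (S : G.Subgraph) : (S.map φ.toHom).comap φ.toHom = S := by
  ext x y
  · simp
  · simp only [Subgraph.comap_adj, Subgraph.map_adj, Relation.Map]
    constructor
    · rintro ⟨-, a, b, h, ha, hb⟩
      obtain rfl : a = x := φ.injective ha
      obtain rfl : b = y := φ.injective hb
      exact h
    · exact fun h => ⟨S.adj_sub h, x, y, h, rfl, rfl⟩

lemma coreIndexAt_le_of_iso [Finite W] {G : SimpleGraph V} {H : SimpleGraph W} (φ : G ≃g H)
    (A : Set V) : G.coreIndexAt A ≤ H.coreIndexAt (φ '' A) := by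
  refine Set.ncard_le_ncard_of_injOn (fun S => S.map φ.toHom) ?_ ?_ (Set.toFinite _)
  · rintro S ⟨hS, hA⟩
    exact ⟨hS.map_iso φ, Set.image_mono hA⟩
  · intro S _ T _ h
    have h' : S.map φ.toHom = T.map φ.toHom := h
    refine le_antisymm ?_ ?_
    · have := (Subgraph.map_le_iff_le_comap φ.toHom S _).1 h'.le
      rwa [Subgraph.comap_map_iso] at this
    · have := (Subgraph.map_le_iff_le_comap φ.toHom T _).1 h'.ge
      rwa [Subgraph.comap_map_iso] at this

lemma coreIndexAt_iso [Finite V] [Finite W] {G : SimpleGraph V} {H : SimpleGraph W} (φ : G ≃g H)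
    (A : Set V) : G.coreIndexAt A = H.coreIndexAt (φ '' A) := by
  refine (coreIndexAt_le_of_iso φ A).antisymm ?_
  have h := coreIndexAt_le_of_iso φ.symm (φ '' A)
  rw [← Set.image_comp] at h
  simpa using h

lemma coreIndex_iso [Finite V] [Finite W] {G : SimpleGraph V} {H : SimpleGraph W} (φ : G ≃g H) :
    coreIndex G = coreIndex H := by
  simp [coreIndex_eq_coreIndexAt, coreIndexAt_iso φ]

lemma coreIndexAt_singleton_iso [Finite V] [Finite W] {G : SimpleGraph V} {H : SimpleGraph W}
    (φ : G ≃g H) (w : V) : G.coreIndexAt {w} = H.coreIndexAt {φ w} := by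
  simp [coreIndexAt_iso φ]

/-! ### Connected subgraphs after attaching a leaf -/

/-- The graph obtained from `H` by attaching a pendant vertex `none` to the vertex `u`. -/
def addLeaf (H : SimpleGraph V) (u : V) : SimpleGraph (Option V) where
  Adj
    | some x, some y => H.Adj x y
    | some x, none => x = u
    | none, some y => y = u
    | none, none => False
  symm := ⟨by
    rintro (_ | x) (_ | y) h
    exacts [h, h, h, Adj.symm (G := H) h]⟩
  loopless := ⟨by
    rintro (_ | x) h
    exacts [h, H.loopless.irrefl _ h]⟩

section addLeaf

variable {H : SimpleGraph V} {u : V}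

@[simp] lemma addLeaf_some_some {x y : V} : (addLeaf H u).Adj (some x) (some y) ↔ H.Adj x y :=
  Iff.rfl

@[simp] lemma addLeaf_some_none {x : V} : (addLeaf H u).Adj (some x) none ↔ x = u := Iff.rfl

@[simp] lemma addLeaf_none_some {y : V} : (addLeaf H u).Adj none (some y) ↔ y = u := Iff.rfl

lemma addLeaf_none_adj (H : SimpleGraph V) (u : V) : (addLeaf H u).Adj none (some u) := rfl

/-- Attaching a pendant vertex is compatible with isomorphisms. -/
def addLeafIso {H' : SimpleGraph W} (φ : H ≃g H') {u' : W} (hu : φ u = u') :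
    addLeaf H u ≃g addLeaf H' u' where
  toEquiv := Equiv.optionCongr φ.toEquiv
  map_rel_iff' := by
    subst hu
    rintro (_ | x) (_ | y) <;> simp [φ.map_adj_iff]

/-- A subgraph of `H`, seen as a subgraph of `addLeaf H u`. -/
def Subgraph.liftLeaf (u : V) (S : H.Subgraph) : (addLeaf H u).Subgraph where
  verts := some '' S.verts
  Adj a b := ∃ x y, a = some x ∧ b = some y ∧ S.Adj x y
  adj_sub := by
    rintro _ _ ⟨x, y, rfl, rfl, h⟩
    exact S.adj_sub h
  edge_vert := by
    rintro _ _ ⟨x, y, rfl, rfl, h⟩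
    exact ⟨x, S.edge_vert h, rfl⟩
  symm := ⟨by
    rintro _ _ ⟨x, y, rfl, rfl, h⟩
    exact ⟨y, x, rfl, rfl, h.symm⟩⟩

/-- A subgraph of `H` together with the pendant edge of `addLeaf H u`. -/
def Subgraph.extendLeaf (u : V) (S : H.Subgraph) : (addLeaf H u).Subgraph :=
  S.liftLeaf u ⊔ (addLeaf H u).subgraphOfAdj (addLeaf_none_adj H u)

/-- The part of a subgraph of `addLeaf H u` in `H`. -/
def Subgraph.restrictLeaf (T : (addLeaf H u).Subgraph) : H.Subgraph where
  verts := some ⁻¹' T.verts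
  Adj x y := T.Adj (some x) (some y)
  adj_sub h := T.adj_sub h
  edge_vert h := T.edge_vert h
  symm := ⟨fun _ _ h => h.symm⟩

namespace Subgraph

lemma restrictLeaf_liftLeaf (S : H.Subgraph) : (S.liftLeaf u).restrictLeaf = S := by
  ext <;> simp [liftLeaf, restrictLeaf]

lemma restrictLeaf_extendLeaf {S : H.Subgraph} (hu : u ∈ S.verts) :
    (S.extendLeaf u).restrictLeaf = S := by
  ext x y
  · simp only [restrictLeaf, extendLeaf, liftLeaf, verts_sup, Set.mem_preimage, Set.mem_union]
    constructor
    · rintro (h | h)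
      · simpa using h
      · obtain rfl : x = u := by simpa using h
        exact hu
    · exact fun h => Or.inl ⟨x, h, rfl⟩
  · simp [restrictLeaf, extendLeaf, liftLeaf]

lemma eq_liftLeaf {T : (addLeaf H u).Subgraph} (hT : none ∉ T.verts) :
    T.restrictLeaf.liftLeaf u = T := by
  ext a b
  · rcases a with _ | x <;> simp [liftLeaf, restrictLeaf, hT]
  · rcases a with _ | x
    · have : ¬ T.Adj none b := fun h => hT h.fst_mem
      simp [liftLeaf, restrictLeaf, this]
    rcases b with _ | y
    · have : ¬ T.Adj (some x) none := fun h => hT h.snd_mem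
      simp [liftLeaf, restrictLeaf, this]
    · simp [liftLeaf, restrictLeaf]

lemma eq_extendLeaf {T : (addLeaf H u).Subgraph} (hT : T.Adj none (some u)) :
    T.restrictLeaf.extendLeaf u = T := by
  have h0 : none ∈ T.verts := hT.fst_mem
  have hu : some u ∈ T.verts := hT.snd_mem
  ext a b
  · rcases a with _ | x
    · simp [extendLeaf, h0]
    · simp only [extendLeaf, liftLeaf, restrictLeaf, verts_sup, Set.mem_union]
      constructor
      · rintro (h | h)
        · simpa using h
        · obtain rfl : x = u := by simpa using h
          exact hu
      · exact fun h => Or.inl ⟨x, h, rfl⟩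
  · rcases a with _ | x <;> rcases b with _ | y
    · have : ¬ T.Adj none none := fun h => T.adj_sub h
      simp [extendLeaf, liftLeaf, restrictLeaf, this]
    · have : T.Adj none (some y) ↔ u = y :=
        ⟨fun h => Eq.symm (a := y) (T.adj_sub h), fun h => h ▸ hT⟩
      simp [extendLeaf, liftLeaf, restrictLeaf, this]
    · have : T.Adj (some x) none ↔ u = x :=
        ⟨fun h => Eq.symm (a := x) (T.adj_sub h), fun h => h ▸ hT.symm⟩
      simp [extendLeaf, liftLeaf, restrictLeaf, this]
    · simp [extendLeaf, liftLeaf, restrictLeaf]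

lemma Connected.liftLeaf {S : H.Subgraph} (hS : S.Connected) : (S.liftLeaf u).Connected := by
  rw [connected_iff_reflTransGen] at hS ⊢
  refine ⟨hS.1.image _, ?_⟩
  rintro _ ⟨a, ha, rfl⟩ _ ⟨b, hb, rfl⟩
  exact (hS.2 a ha b hb).lift (p := (S.liftLeaf u).Adj) _ fun x y hxy => ⟨x, y, rfl, rfl, hxy⟩

lemma Connected.extendLeaf {S : H.Subgraph} (hS : S.Connected) (hu : u ∈ S.verts) :
    (S.extendLeaf u).Connected :=
  Subgraph.connected_sup hS.liftLeaf.preconnected (subgraphOfAdj_connected _).preconnected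
    ⟨some u, ⟨u, hu, rfl⟩, by simp⟩

lemma Connected.restrictLeaf {T : (addLeaf H u).Subgraph} (hT : T.Connected)
    (hne : T.verts ≠ {none}) : T.restrictLeaf.Connected := by
  rw [connected_iff_reflTransGen] at hT ⊢
  obtain ⟨a, ha, ha0⟩ : ∃ a ∈ T.verts, a ≠ none := by
    by_contra! h
    exact hne (hT.1.subset_singleton_iff.1 h)
  obtain ⟨x, rfl⟩ := Option.ne_none_iff_exists'.1 ha0
  refine ⟨⟨x, ha⟩, fun y hy z hz => ?_⟩
  -- Collapsing the leaf onto `u` makes the pendant edge trivial, so chains in `T` become chains in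
  -- the restriction.
  have key : ∀ b c, T.Adj b c →
      Relation.ReflTransGen T.restrictLeaf.Adj (b.getD u) (c.getD u) := by
    rintro (_ | b) (_ | c) h
    · exact .refl
    · obtain rfl : c = u := T.adj_sub h
      exact .refl
    · obtain rfl : b = u := T.adj_sub h
      exact .refl
    · exact .single h
  have h := hT.2 _ hy _ hz
  exact Relation.ReflTransGen.lift' (fun b : Option V => b.getD u) key _ _ h

end Subgraph

lemma injOn_liftLeaf (s : Set H.Subgraph) : Set.InjOn (Subgraph.liftLeaf u) s := by
  intro S _ T _ h
  rw [← S.restrictLeaf_liftLeaf (u := u), h, T.restrictLeaf_liftLeaf]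

lemma injOn_extendLeaf {A : Set V} (hA : u ∈ A) :
    Set.InjOn (Subgraph.extendLeaf u) (H.connectedSubgraphs A) := by
  intro S hS T hT h
  rw [← Subgraph.restrictLeaf_extendLeaf (hS.2 hA), h, Subgraph.restrictLeaf_extendLeaf (hT.2 hA)]

lemma none_mem_extendLeaf (S : H.Subgraph) : none ∈ (S.extendLeaf u).verts := by
  simp [Subgraph.extendLeaf]

lemma none_notMem_liftLeaf (S : H.Subgraph) : none ∉ (S.liftLeaf u).verts := by
  simp [Subgraph.liftLeaf]

lemma Subgraph.Connected.pendant_adj {T : (addLeaf H u).Subgraph} (hT : T.Connected)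
    (h0 : none ∈ T.verts) (hne : T.verts ≠ {none}) : T.Adj none (some u) := by
  obtain ⟨a, ha, ha0⟩ : ∃ a ∈ T.verts, a ≠ none := by
    by_contra! h
    exact hne (hT.nonempty.subset_singleton_iff.1 h)
  rcases ((connected_iff_reflTransGen.1 hT).2 _ h0 _ ha).cases_head with h | ⟨b, hb, -⟩
  · exact absurd h.symm ha0
  · rcases b with _ | b
    · exact (T.adj_sub hb).elim
    · obtain rfl : b = u := T.adj_sub hb
      exact hb

/-- The connected subgraphs of `addLeaf H u` avoiding the pendant vertex. -/
lemma connectedSubgraphs_addLeaf_avoid (A : Set V) :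
    {T ∈ (addLeaf H u).connectedSubgraphs (some '' A) | none ∉ T.verts} =
      Subgraph.liftLeaf u '' H.connectedSubgraphs A := by
  ext T
  constructor
  · rintro ⟨⟨hT, hA⟩, h0⟩
    refine ⟨T.restrictLeaf, ⟨hT.restrictLeaf ?_, fun x hx => hA ⟨x, hx, rfl⟩⟩,
      Subgraph.eq_liftLeaf h0⟩
    rintro h
    simp [h] at h0
  · rintro ⟨S, ⟨hS, hA⟩, rfl⟩
    exact ⟨⟨hS.liftLeaf, Set.image_mono hA⟩, none_notMem_liftLeaf S⟩

/-- The connected subgraphs of `addLeaf H u` containing the pendant vertex, other than the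
pendant vertex alone. -/
lemma connectedSubgraphs_addLeaf_pendant (A : Set V) :
    {T ∈ (addLeaf H u).connectedSubgraphs (some '' A) | none ∈ T.verts ∧ T.verts ≠ {none}} =
      Subgraph.extendLeaf u '' H.connectedSubgraphs (insert u A) := by
  ext T
  constructor
  · rintro ⟨⟨hT, hA⟩, h0, hne⟩
    have hadj := hT.pendant_adj h0 hne
    exact ⟨T.restrictLeaf, ⟨hT.restrictLeaf hne,
      Set.insert_subset hadj.snd_mem fun x hx => hA ⟨x, hx, rfl⟩⟩, Subgraph.eq_extendLeaf hadj⟩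
  · rintro ⟨S, ⟨hS, hA⟩, rfl⟩
    have hu : u ∈ S.verts := hA (Set.mem_insert _ _)
    refine ⟨⟨hS.extendLeaf hu, ?_⟩, none_mem_extendLeaf S, fun h => ?_⟩
    · rintro _ ⟨x, hx, rfl⟩
      exact Or.inl ⟨x, hA (Set.mem_insert_of_mem _ hx), rfl⟩
    · have : some u ∈ (S.extendLeaf u).verts := Or.inl ⟨u, hu, rfl⟩
      simp [h] at this

lemma connected_and_verts_eq_singleton_iff {G : SimpleGraph V} {v : V} {T : G.Subgraph} :
    (T.Connected ∧ T.verts = {v}) ↔ T = G.singletonSubgraph v := by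
  constructor
  · rintro ⟨-, h⟩
    ext x y
    · simp [h]
    · have : ¬ T.Adj x y := fun hxy => by
        have h1 := hxy.fst_mem
        have h2 := hxy.snd_mem
        rw [h, Set.mem_singleton_iff] at h1 h2
        exact hxy.adj_sub.ne (h1.trans h2.symm)
      simp [this]
  · rintro rfl
    exact ⟨Subgraph.singletonSubgraph_connected, rfl⟩

/-- Since `A` is nonempty, the leaf alone is excluded and only two classes remain. -/
lemma coreIndexAt_addLeaf_some [Finite V] (H : SimpleGraph V) (u : V) {A : Set V}
    (hA : A.Nonempty) : (addLeaf H u).coreIndexAt (some '' A) =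
      H.coreIndexAt A + H.coreIndexAt (insert u A) := by
  have hsplit : (addLeaf H u).connectedSubgraphs (some '' A) =
      Subgraph.liftLeaf u '' H.connectedSubgraphs A ∪
        Subgraph.extendLeaf u '' H.connectedSubgraphs (insert u A) := by
    rw [← connectedSubgraphs_addLeaf_avoid, ← connectedSubgraphs_addLeaf_pendant]
    obtain ⟨x, hx⟩ := hA
    ext T
    have : some '' A ⊆ T.verts → T.verts ≠ {none} := fun h h' => by
      have := h ⟨x, hx, rfl⟩
      simp [h'] at this
    simp only [connectedSubgraphs, Set.mem_union, Set.mem_ofPred_eq]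
    tauto
  have hd : Disjoint (Subgraph.liftLeaf u '' H.connectedSubgraphs A)
      (Subgraph.extendLeaf u '' H.connectedSubgraphs (insert u A)) := by
    rw [← connectedSubgraphs_addLeaf_avoid, ← connectedSubgraphs_addLeaf_pendant]
    exact Set.disjoint_left.2 fun T h1 h2 => h1.2 h2.2.1
  rw [coreIndexAt, hsplit, Set.ncard_union_eq hd (Set.toFinite _) (Set.toFinite _),
    (injOn_liftLeaf _).ncard_image, (injOn_extendLeaf (Set.mem_insert _ _)).ncard_image]
  rfl

lemma coreIndexAt_addLeaf_singleton_some [Finite V] (H : SimpleGraph V) (u w : V) :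
    (addLeaf H u).coreIndexAt {some w} = H.coreIndexAt {w} + H.coreIndexAt {u, w} := by
  simpa using coreIndexAt_addLeaf_some H u (Set.singleton_nonempty w)

/-- The `1` counts the leaf alone; every other subgraph through the leaf uses the pendant edge. -/
lemma coreIndexAt_addLeaf_none [Finite V] (H : SimpleGraph V) (u : V) :
    (addLeaf H u).coreIndexAt {none} = H.coreIndexAt {u} + 1 := by
  have hd : (addLeaf H u).singletonSubgraph none ∉
      Subgraph.extendLeaf u '' H.connectedSubgraphs (insert u ∅) := by
    rw [← connectedSubgraphs_addLeaf_pendant]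
    exact fun h => h.2.2 rfl
  have hsplit : (addLeaf H u).connectedSubgraphs {none} =
      insert ((addLeaf H u).singletonSubgraph none)
        (Subgraph.extendLeaf u '' H.connectedSubgraphs (insert u ∅)) := by
    rw [← connectedSubgraphs_addLeaf_pendant]
    ext T
    have h0 : T.verts = {none} → none ∈ T.verts := fun h => by simp [h]
    simp only [connectedSubgraphs, Set.mem_insert_iff, Set.mem_ofPred_eq,
      ← connected_and_verts_eq_singleton_iff, Set.singleton_subset_iff, Set.image_empty, Set.empty_subset]
    tauto
  rw [coreIndexAt, hsplit, Set.ncard_insert_of_notMem hd (Set.toFinite _),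
    (injOn_extendLeaf (Set.mem_insert _ _)).ncard_image, insert_empty_eq]
  rfl

lemma coreIndexAt_addLeaf_empty [Finite V] (H : SimpleGraph V) (u : V) :
    (addLeaf H u).coreIndexAt ∅ = H.coreIndexAt ∅ + (H.coreIndexAt {u} + 1) := by
  have hsplit : (addLeaf H u).connectedSubgraphs ∅ =
      Subgraph.liftLeaf u '' H.connectedSubgraphs ∅ ∪ (addLeaf H u).connectedSubgraphs {none} := by
    rw [← connectedSubgraphs_addLeaf_avoid]
    ext T
    simp only [connectedSubgraphs, Set.mem_union, Set.mem_ofPred_eq, Set.singleton_subset_iff,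
      Set.image_empty, Set.empty_subset]
    tauto
  have hd : Disjoint (Subgraph.liftLeaf u '' H.connectedSubgraphs ∅)
      ((addLeaf H u).connectedSubgraphs {none}) := by
    rw [← connectedSubgraphs_addLeaf_avoid]
    exact Set.disjoint_left.2 fun T h1 h2 => h1.2 (h2.2 rfl)
  rw [← coreIndexAt_addLeaf_none, coreIndexAt, hsplit,
    Set.ncard_union_eq hd (Set.toFinite _) (Set.toFinite _), (injOn_liftLeaf _).ncard_image]
  rfl

end addLeaf

/-- The single vertex `w` is a subgraph that misses `u`. This strictness is what settles the
equality case. -/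
lemma coreIndexAt_insert_lt [Finite V] (G : SimpleGraph V) {u w : V} (h : u ≠ w) :
    G.coreIndexAt {u, w} < G.coreIndexAt {w} := by
  refine Set.ncard_lt_ncard ((Set.ssubset_iff_of_subset ?_).2
    ⟨G.singletonSubgraph w, ?_, ?_⟩) (Set.toFinite _)
  · exact fun S hS => ⟨hS.1, (Set.subset_insert _ _).trans hS.2⟩
  · exact ⟨Subgraph.singletonSubgraph_connected, subset_rfl⟩
  · exact fun hS => h (hS.2 (Set.mem_insert _ _))

/-- The single vertex and the whole graph are two different examples. Used to get `F(u) + 1 < 2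
F(u)`. -/
lemma one_lt_coreIndexAt_singleton [Finite V] [Nontrivial V] {G : SimpleGraph V}
    (hG : G.Connected) (u : V) : 1 < G.coreIndexAt {u} := by
  obtain ⟨v, hv⟩ := exists_ne u
  refine (Set.one_lt_ncard (Set.toFinite _)).2 ⟨G.singletonSubgraph u,
    ⟨Subgraph.singletonSubgraph_connected, subset_rfl⟩, ⊤, ⟨?_, by simp⟩, fun h => ?_⟩
  · exact (Subgraph.connected_iff').2 (Subgraph.topIso.connected_iff.2 hG)
  · have : v ∈ (G.singletonSubgraph u).verts := by rw [h]; trivial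
    exact hv this

/-! ### Arcs and connected subgraphs of a cycle -/

/-- The cycle on the integers modulo `k + 3`. -/
def zmodCycle (k : ℕ) : SimpleGraph (ZMod (k + 3)) where
  Adj a b := b = a + 1 ∨ a = b + 1
  symm := ⟨fun _ _ h => h.symm⟩
  loopless := ⟨fun a h => by
    have : Fact (1 < k + 3) := ⟨by lia⟩
    simp at h⟩

/-- The two models of the cycle are isomorphic. -/
def zmodCycleIso (k : ℕ) : zmodCycle k ≃g cycleGraph (k + 3) where
  toEquiv := Equiv.refl (Fin (k + 3))
  map_rel_iff' := by
    intro a b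
    change (a - b : ZMod (k + 3)) = 1 ∨ (b - a : ZMod (k + 3)) = 1 ↔ b = a + 1 ∨ a = b + 1
    rw [sub_eq_iff_eq_add', sub_eq_iff_eq_add', or_comm]

section arcs

variable {k : ℕ}

/-- With at least three vertices an edge has only one orientation `x → x + 1`; this discards the
second disjunct in `arc_adj_add_one`. -/
lemma zmod_ne_add_two (x : ZMod (k + 3)) : x ≠ x + 1 + 1 := by
  intro h
  have h2 : ((2 : ℕ) : ZMod (k + 3)) = 0 := by
    push_cast
    linear_combination -h
  have := congrArg ZMod.val h2
  rw [ZMod.val_natCast_of_lt (by lia), ZMod.val_zero] at this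
  lia

lemma zmod_val_sub_one {d : ZMod (k + 3)} (hd : d ≠ 0) : (d - 1).val + 1 = d.val := by
  have h1 : 1 ≤ d.val := Nat.one_le_iff_ne_zero.2 fun h => hd ((ZMod.val_eq_zero d).1 h)
  have h2 := d.val_lt
  have h3 : d - 1 = ((d.val - 1 : ℕ) : ZMod (k + 3)) := by
    rw [Nat.cast_sub h1, ZMod.natCast_zmod_val, Nat.cast_one]
  rw [h3, ZMod.val_natCast_of_lt (by lia)]
  lia

/-- Lying below another residue keeps `d` off the top value, so adding `1` does not wrap around. -/
lemma zmod_val_add_one {d e : ZMod (k + 3)} (h : d.val < e.val) : (d + 1).val = d.val + 1 := by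
  have hd : d + 1 ≠ 0 := by
    intro h0
    have h3 : d = ((k + 2 : ℕ) : ZMod (k + 3)) := by
      have : ((k + 3 : ℕ) : ZMod (k + 3)) = 0 := ZMod.natCast_self _
      push_cast at this ⊢
      linear_combination h0 - this
    rw [h3, ZMod.val_natCast_of_lt (by lia)] at h
    have := e.val_lt
    lia
  have := zmod_val_sub_one hd
  rw [add_sub_cancel_right] at this
  lia

/-- The path running from `a` upwards to `b` in the cycle. -/
def arc (a b : ZMod (k + 3)) : (zmodCycle k).Subgraph where
  verts := {x | (x - a).val ≤ (b - a).val}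
  Adj x y := (y = x + 1 ∧ (x - a).val < (b - a).val) ∨ (x = y + 1 ∧ (y - a).val < (b - a).val)
  adj_sub h := h.imp And.left And.left
  edge_vert := by
    rintro x y (⟨-, h⟩ | ⟨rfl, h⟩)
    · exact h.le
    · have := zmod_val_add_one h
      change (y + 1 - a).val ≤ _
      rw [show y + 1 - a = y - a + 1 by ring]
      lia
  symm := ⟨fun _ _ h => h.symm⟩

lemma arc_adj_add_one {a b x : ZMod (k + 3)} :
    (arc a b).Adj x (x + 1) ↔ (x - a).val < (b - a).val := by
  simp [arc, zmod_ne_add_two]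

lemma mem_arc {a b x : ZMod (k + 3)} : x ∈ (arc a b).verts ↔ (x - a).val ≤ (b - a).val := Iff.rfl

/-- Together with `eq_end_iff`, this recovers the endpoints from the subgraph, so different pairs
give different arcs. -/
lemma eq_start_iff {a b x : ZMod (k + 3)} :
    x = a ↔ x ∈ (arc a b).verts ∧ ¬ (arc a b).Adj (x - 1) (x - 1 + 1) := by
  rw [arc_adj_add_one, mem_arc]
  constructor
  · rintro rfl
    refine ⟨by simp, ?_⟩
    intro h
    have := zmod_val_add_one h
    rw [show x - 1 - x + 1 = 0 by ring, ZMod.val_zero] at this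
    lia
  · rintro ⟨h1, h2⟩
    by_contra hne
    have := zmod_val_sub_one (sub_ne_zero.2 hne)
    rw [show x - 1 - a = x - a - 1 by ring] at h2
    lia

lemma eq_end_iff {a b x : ZMod (k + 3)} :
    x = b ↔ x ∈ (arc a b).verts ∧ ¬ (arc a b).Adj x (x + 1) := by
  rw [arc_adj_add_one, mem_arc]
  constructor
  · rintro rfl
    simp
  · rintro ⟨h1, h2⟩
    have : x - a = b - a := ZMod.val_injective _ (by lia)
    simpa using this

lemma arc_injective :
    Function.Injective fun p : ZMod (k + 3) × ZMod (k + 3) => arc p.1 p.2 := by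
  rintro ⟨a, b⟩ ⟨a', b'⟩ h
  have h : arc a b = arc a' b' := h
  have h1 := (eq_start_iff (a := a) (b := b)).1 rfl
  have h2 := (eq_end_iff (a := a) (b := b)).1 rfl
  rw [h] at h1 h2
  rw [eq_start_iff.2 h1, eq_end_iff.2 h2]

lemma arc_connected (a b : ZMod (k + 3)) : (arc a b).Connected := by
  rw [Subgraph.connected_iff_reflTransGen]
  have key : ∀ j : ℕ, j ≤ (b - a).val → Relation.ReflTransGen (arc a b).Adj a (a + j) := by
    intro j
    induction j with
    | zero => simpa using Relation.ReflTransGen.refl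
    | succ j ih =>
      intro hj
      refine (ih (by lia)).tail ?_
      rw [show a + ((j + 1 : ℕ) : ZMod (k + 3)) = a + j + 1 by push_cast; ring, arc_adj_add_one,
        add_sub_cancel_left, ZMod.val_natCast_of_lt (by have := (b - a).val_lt; lia)]
      lia
  have key' : ∀ x ∈ (arc a b).verts, Relation.ReflTransGen (arc a b).Adj a x := by
    intro x hx
    have := key (x - a).val hx
    rwa [ZMod.natCast_zmod_val, add_sub_cancel] at this
  have : Std.Symm (arc a b).Adj := (arc a b).symm
  exact ⟨⟨a, by simp [mem_arc]⟩, fun x hx y hy => (Std.Symm.symm _ _ (key' x hx)).trans (key' y hy)⟩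

lemma exists_eq_arc {S : (zmodCycle k).Subgraph} (hS : S.Connected) {x₀ : ZMod (k + 3)}
    (hx₀ : ¬ S.Adj x₀ (x₀ + 1)) : ∃ a b, arc a b = S := by
  -- The starting point: if every vertex had its backward edge, walking back from any vertex would
  -- reach `x₀ + 1` and force the missing edge.
  obtain ⟨a, ha, ha'⟩ : ∃ a ∈ S.verts, ¬ S.Adj (a - 1) a := by
    by_contra! h
    obtain ⟨v, hv⟩ := hS.nonempty
    have hall : ∀ j : ℕ, v - j ∈ S.verts := by
      intro j
      induction j with
      | zero => simpa
      | succ j ih =>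
        have := (h _ ih).fst_mem
        rwa [show v - j - 1 = v - ((j + 1 : ℕ) : ZMod (k + 3)) by push_cast; ring] at this
    have h1 := hall (v - (x₀ + 1)).val
    rw [ZMod.natCast_zmod_val, sub_sub_cancel] at h1
    have := h _ h1
    rw [add_sub_cancel_right] at this
    exact hx₀ this
  have hex : ∃ j : ℕ, ¬ S.Adj (a + j) (a + j + 1) := by
    refine ⟨(-1 : ZMod (k + 3)).val, ?_⟩
    rw [ZMod.natCast_zmod_val, ← sub_eq_add_neg, sub_add_cancel]
    exact ha'
  classical
  -- `m` is the length of the run of consecutive edges starting at `a`, so the arc must end at `a +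
  -- m`.
  obtain ⟨m, hm, hmin⟩ : ∃ m : ℕ, ¬ S.Adj (a + m) (a + m + 1) ∧
      ∀ j < m, S.Adj (a + j) (a + j + 1) :=
    ⟨Nat.find hex, Nat.find_spec hex, fun j hj => not_not.1 (Nat.find_min hex hj)⟩
  have hmlt : m < k + 3 := by
    by_contra! hle
    have := hmin (-1 : ZMod (k + 3)).val ((ZMod.val_lt _).trans_le hle)
    rw [ZMod.natCast_zmod_val, ← sub_eq_add_neg, sub_add_cancel] at this
    exact ha' this
  have hval : (a + m - a).val = m := by
    rw [add_sub_cancel_left, ZMod.val_natCast_of_lt hmlt]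
  have hrep : ∀ x : ZMod (k + 3), a + ((x - a).val : ZMod (k + 3)) = x := fun x => by
    rw [ZMod.natCast_zmod_val, add_sub_cancel]
  -- No edge of `S` leaves the arc: forward at `a + m` is excluded by `hm`, backward at `a` by
  -- `ha'`.
  have hstep : ∀ x y, x ∈ (arc a (a + m)).verts → S.Adj x y → (arc a (a + m)).Adj x y := by
    intro x y hx hxy
    rw [mem_arc, hval] at hx
    rcases S.adj_sub hxy with rfl | rfl
    · rw [arc_adj_add_one, hval]
      refine lt_of_le_of_ne hx fun h => hm ?_
      rwa [← h, hrep]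
    · refine Subgraph.Adj.symm (arc_adj_add_one.2 ?_)
      rw [hval]
      have hne : y + 1 ≠ a := by
        rintro rfl
        rw [add_sub_cancel_right] at ha'
        exact ha' hxy.symm
      have := zmod_val_sub_one (sub_ne_zero.2 hne)
      rw [show y + 1 - a - 1 = y - a by ring] at this
      lia
  have hsub : ∀ x ∈ S.verts, x ∈ (arc a (a + m)).verts := by
    intro x hx
    have := (Subgraph.connected_iff_reflTransGen.1 hS).2 a ha x hx
    induction this with
    | refl => simp [mem_arc]
    | tail _ hyz ih => exact (hstep _ _ (ih hyz.fst_mem) hyz).snd_mem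
  have hle : S ≤ arc a (a + m) := ⟨hsub, fun x y hxy => hstep x y (hsub x hxy.fst_mem) hxy⟩
  suffices hge : arc a (a + m) ≤ S from ⟨a, a + m, hge.antisymm hle⟩
  refine ⟨fun x hx => ?_, fun x y hxy => ?_⟩
  · rw [mem_arc, hval] at hx
    rcases hx.lt_or_eq with h | h
    · have := (hmin _ h).fst_mem
      rwa [hrep] at this
    · rcases Nat.eq_zero_or_pos m with h0 | h0
      · rw [h0, ZMod.val_eq_zero, sub_eq_zero] at h
        rwa [h]
      · have := (hmin (m - 1) (by lia)).snd_mem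
        rw [Nat.cast_sub h0, Nat.cast_one, show a + (m - 1 : ZMod (k + 3)) + 1 = a + m by ring,
          ← h, hrep] at this
        exact this
  · have aux : ∀ z, (z - a).val < (a + m - a).val → S.Adj z (z + 1) := fun z hz => by
      have := hmin _ (hval ▸ hz)
      rwa [hrep] at this
    rcases hxy with ⟨rfl, h⟩ | ⟨rfl, h⟩
    · exact aux _ h
    · exact (aux _ h).symm

lemma zmodCycle_subgraph_eq_top {S : (zmodCycle k).Subgraph} (h : ∀ x, S.Adj x (x + 1)) :
    S = ⊤ := by
  ext x y
  · simpa using (h x).fst_mem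
  · constructor
    · exact fun h => S.adj_sub h
    · rintro (rfl | rfl)
      exacts [h _, (h _).symm]

lemma zmodCycle_connected (k : ℕ) : (zmodCycle k).Connected :=
  (zmodCycleIso k).connected_iff.2 cycleGraph_connected

/-- A connected subgraph either has every edge or misses one, and then it is an arc. -/
lemma connectedSubgraphs_zmodCycle (A : Set (ZMod (k + 3))) :
    (zmodCycle k).connectedSubgraphs A = insert ⊤
      ((fun p : ZMod (k + 3) × ZMod (k + 3) => arc p.1 p.2) ''
        {p | A ⊆ (arc p.1 p.2).verts}) := by
  ext S
  constructor
  · rintro ⟨hS, hA⟩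
    by_cases h : ∀ x, S.Adj x (x + 1)
    · exact Or.inl (zmodCycle_subgraph_eq_top h)
    · push Not at h
      obtain ⟨x, hx⟩ := h
      obtain ⟨a, b, rfl⟩ := exists_eq_arc hS hx
      exact Or.inr ⟨(a, b), hA, rfl⟩
  · rintro (rfl | ⟨p, hp, rfl⟩)
    · exact ⟨Subgraph.connected_iff'.2
        (Subgraph.topIso.connected_iff.2 (zmodCycle_connected k)), by simp⟩
    · exact ⟨arc_connected _ _, hp⟩

lemma coreIndexAt_zmodCycle (A : Set (ZMod (k + 3))) :
    (zmodCycle k).coreIndexAt A =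
      {p : ZMod (k + 3) × ZMod (k + 3) | A ⊆ (arc p.1 p.2).verts}.ncard + 1 := by
  rw [coreIndexAt, connectedSubgraphs_zmodCycle, Set.ncard_insert_of_notMem ?_ (Set.toFinite _),
    arc_injective.injOn.ncard_image]
  -- The whole cycle is not an arc, since an arc has no edge going forward from its end.
  rintro ⟨p, -, hp⟩
  have hp : arc p.1 p.2 = ⊤ := hp
  have := (eq_end_iff (a := p.1) (b := p.2)).1 rfl
  rw [hp] at this
  exact this.2 (Or.inl rfl)

lemma coreIndexAt_zmodCycle_empty : (zmodCycle k).coreIndexAt ∅ = (k + 3) ^ 2 + 1 := by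
  rw [coreIndexAt_zmodCycle]
  simp [Set.ncard_univ, sq]

lemma coreIndexAt_zmodCycle_singleton (w : ZMod (k + 3)) :
    (zmodCycle k).coreIndexAt {w} = (k + 4).choose 2 + 1 := by
  rw [coreIndexAt_zmodCycle]
  congr 1
  -- An arc through `w` is encoded by its length `q = b - a` and the position `p = w - a` of `w` in
  -- it; a given `q` allows `q.val + 1` positions.
  let f : (_ : ZMod (k + 3)) × ZMod (k + 3) → ZMod (k + 3) × ZMod (k + 3) :=
    fun s => (w - s.2, w - s.2 + s.1)
  have hf : Function.Injective f := by
    rintro ⟨q, p⟩ ⟨q', p'⟩ h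
    obtain ⟨h1, h2⟩ := Prod.mk.inj h
    obtain rfl : p = p' := sub_right_injective h1
    obtain rfl : q = q' := add_right_injective _ h2
    rfl
  let t : Finset ((_ : ZMod (k + 3)) × ZMod (k + 3)) :=
    Finset.univ.sigma fun q => {p | p.val ≤ q.val}
  have hq : ∀ q : Fin (k + 3), ({p | p.val ≤ q.val} : Finset (Fin (k + 3))).card = q + 1 := by
    intro q
    rw [← Fin.card_Iic q]
    congr 1
    ext p
    simp
  have ht : t.card = (k + 4).choose 2 := by
    refine (Finset.card_sigma _ _).trans ((Finset.sum_congr rfl fun q _ => hq q).trans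
      ((Fin.sum_univ_eq_sum_range (fun i => i + 1) (k + 3)).trans ?_))
    rw [Nat.choose_two_right, ← Finset.sum_range_id (k + 4)]
    exact (Finset.sum_range_succ' (fun i => i) (k + 3)).symm
  have hmem : ∀ q p : ZMod (k + 3), (⟨q, p⟩ : (_ : ZMod (k + 3)) × ZMod (k + 3)) ∈ t ↔
      p.val ≤ q.val := by
    simp [t]
  have himg : {p : ZMod (k + 3) × ZMod (k + 3) | {w} ⊆ (arc p.1 p.2).verts} = f '' t := by
    ext ⟨a, b⟩
    simp only [Set.mem_ofPred_eq, Set.singleton_subset_iff, mem_arc, Set.mem_image]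
    constructor
    · exact fun h => ⟨⟨b - a, w - a⟩, (hmem _ _).2 h, by simp [f]⟩
    · rintro ⟨⟨q, p⟩, h, h'⟩
      obtain ⟨rfl, rfl⟩ := Prod.mk.inj h'
      simpa using (hmem q p).1 h
  rw [himg, hf.injOn.ncard_image, Set.ncard_coe_finset, ht]

end arcs

/-! ### Unicyclicity and girth after attaching a leaf -/

lemma isUnicyclic_iso [Finite V] [Finite W] {G : SimpleGraph V} {H : SimpleGraph W}
    (φ : G ≃g H) : IsUnicyclic G ↔ IsUnicyclic H := by
  unfold IsUnicyclic
  rw [φ.connected_iff, ← Nat.card_coe_set_eq, ← Nat.card_coe_set_eq,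
    Nat.card_congr φ.mapEdgeSet, Nat.card_congr φ.toEquiv]

section addLeaf

variable {H : SimpleGraph V} {u : V}

lemma edgeSet_addLeaf : (addLeaf H u).edgeSet =
    insert s(none, some u) (Sym2.map some '' H.edgeSet) := by
  ext e
  induction e using Sym2.ind with
  | _ a b =>
    rw [mem_edgeSet, Set.mem_insert_iff, Set.mem_image]
    constructor
    · intro h
      rcases a with _ | a <;> rcases b with _ | b
      · exact h.elim
      · obtain rfl : b = u := h
        exact Or.inl rfl
      · obtain rfl : a = u := h
        exact Or.inl Sym2.eq_swap
      · exact Or.inr ⟨s(a, b), h, rfl⟩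
    · rintro (h | ⟨e, he, h⟩)
      · rw [← mem_edgeSet, h]
        exact addLeaf_none_adj H u
      · induction e using Sym2.ind with
        | _ x y =>
          rw [← mem_edgeSet, ← h]
          exact he

lemma ncard_edgeSet_addLeaf [Finite V] :
    (addLeaf H u).edgeSet.ncard = H.edgeSet.ncard + 1 := by
  rw [edgeSet_addLeaf, Set.ncard_insert_of_notMem ?_ (Set.toFinite _),
    (Sym2.map.injective (Option.some_injective V)).injOn.ncard_image]
  rintro ⟨e, -, he⟩
  have : none ∈ Sym2.map some e := by
    rw [he]
    simp
  simp [Sym2.mem_map] at this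

lemma connected_addLeaf : (addLeaf H u).Connected ↔ H.Connected := by
  constructor
  · intro h
    have : Nonempty V := ⟨u⟩
    refine ⟨fun x y => ?_⟩
    have hxy := (reachable_iff_reflTransGen _ _).1 (h.preconnected (some x) (some y))
    rw [reachable_iff_reflTransGen]
    refine Relation.ReflTransGen.lift' (fun b : Option V => b.getD u) ?_ _ _ hxy
    rintro (_ | b) (_ | c) h
    · exact .refl
    · obtain rfl : c = u := h
      exact .refl
    · obtain rfl : b = u := h
      exact .refl
    · exact .single h
  · intro h
    have key : ∀ a, (addLeaf H u).Reachable (some u) a := by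
      rintro (_ | x)
      · exact (addLeaf_none_adj H u).symm.reachable
      · exact (h.preconnected u x).map (G' := addLeaf H u) ⟨some, id⟩
    exact ⟨fun a b => (key a).symm.trans (key b)⟩

lemma isUnicyclic_addLeaf [Finite V] : IsUnicyclic (addLeaf H u) ↔ IsUnicyclic H := by
  unfold IsUnicyclic
  rw [connected_addLeaf, ncard_edgeSet_addLeaf, Finite.card_option, add_left_inj]

/-- A cycle vertex has two distinct neighbours and the leaf has only one, so no cycle passes through
the leaf. -/
lemma cycleGraph_isContained_addLeaf {n : ℕ} (hn : 2 < n) :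
    (cycleGraph n).IsContained (addLeaf H u) ↔ (cycleGraph n).IsContained H := by
  constructor
  · rintro ⟨f⟩
    obtain ⟨k, rfl⟩ : ∃ k, n = k + 3 := ⟨n - 3, by lia⟩
    have hsome : ∀ x, (f x).isSome := by
      intro x
      by_contra hx
      have hx : f x = none := by simpa using hx
      have h2 : ((cycleGraph (k + 3)).neighborFinset x).card = 2 := cycleGraph_degree_three_le
      obtain ⟨y, z, hyz, h⟩ := Finset.card_eq_two.1 h2
      have hu : ∀ y ∈ (cycleGraph (k + 3)).neighborFinset x, f y = some u := by
        intro y hy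
        have hadj : (addLeaf H u).Adj (f x) (f y) :=
          f.toHom.map_adj ((mem_neighborFinset _ _ _).1 hy)
        rw [hx] at hadj
        rcases hfy : f y with _ | w
        · rw [hfy] at hadj
          exact hadj.elim
        · rw [hfy] at hadj
          exact congrArg some hadj
      exact hyz (f.injective ((hu y (by simp [h])).trans (hu z (by simp [h])).symm))
    refine ⟨⟨⟨fun x => (f x).get (hsome x), fun {x y} hxy => ?_⟩, fun x y hxy => ?_⟩⟩
    · have hadj : (addLeaf H u).Adj (f x) (f y) := f.toHom.map_adj hxy
      rw [← Option.some_get (hsome x), ← Option.some_get (hsome y)] at hadj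
      exact hadj
    · exact f.injective (Option.get_inj.1 hxy)
  · rintro ⟨f⟩
    exact ⟨⟨⟨fun x => some (f x), fun h => f.toHom.map_adj h⟩,
      fun x y h => f.injective (Option.some_injective _ h)⟩⟩

lemma girth_addLeaf : (addLeaf H u).girth = H.girth := by
  unfold girth
  congr 1
  refine le_antisymm (IsContained.egirth_le ⟨⟨⟨some, id⟩, Option.some_injective V⟩⟩)
    (le_egirth.2 fun a w hw => ?_)
  have h3 := hw.three_le_length
  obtain ⟨v, p, hp, hpw⟩ := (cycleGraph_isContained_iff h3).1
    ((cycleGraph_isContained_addLeaf h3).1 ((cycleGraph_isContained_iff h3).2 ⟨a, w, hw, rfl⟩))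
  rw [← hpw]
  exact egirth_le_length hp

/-- A graph with a vertex of degree one arises by attaching a pendant vertex. -/
lemma exists_iso_addLeaf {G : SimpleGraph V} {v : V} (hv : ∃! u, G.Adj v u) :
    ∃ (H : SimpleGraph {x // x ≠ v}) (u : {x // x ≠ v}), Nonempty (G ≃g addLeaf H u) := by
  classical
  obtain ⟨u, hu, huniq⟩ := hv
  refine ⟨G.comap Subtype.val, ⟨u, hu.ne'⟩, ⟨RelIso.symm ⟨Equiv.optionSubtypeNe v, ?_⟩⟩⟩
  have hv' : ∀ x, G.Adj v x ↔ x = u := fun x => ⟨huniq x, fun h => h ▸ hu⟩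
  rintro (_ | ⟨x, hx⟩) (_ | ⟨y, hy⟩)
  · simp
  · simp [hv', Subtype.ext_iff]
  · simp [G.adj_comm x v, hv', Subtype.ext_iff]
  · simp

end addLeaf

/-! ### Unicyclic graphs: the cycle itself, or a graph with a leaf -/

section cycle

variable {G : SimpleGraph V}

/-- The cycle uses both edges at each of its vertices, so its support is closed under adjacency and
by connectedness is everything. -/
lemma Walk.IsCycle.length_eq_card_of_degree_eq_two [Fintype V] [DecidableRel G.Adj]
    (hG : G.Connected) (hdeg : ∀ v, G.degree v = 2) {v : V} {p : G.Walk v v} (hp : p.IsCycle) :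
    p.length = Fintype.card V := by
  classical
  have hclosed : ∀ x ∈ p.support, ∀ y, G.Adj x y → y ∈ p.support := by
    intro x hx y hxy
    have heq : p.toSubgraph.neighborSet x = G.neighborSet x := by
      refine Set.eq_of_subset_of_ncard_le (p.toSubgraph.neighborSet_subset x) ?_ (Set.toFinite _)
      rw [hp.ncard_neighborSet_toSubgraph_eq_two hx, ← Nat.card_coe_set_eq,
        Nat.card_eq_fintype_card, card_neighborSet_eq_degree, hdeg]
    have : y ∈ p.toSubgraph.neighborSet x := heq ▸ hxy
    exact p.mem_verts_toSubgraph.1 (Subgraph.Adj.snd_mem this)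
  have hall : ∀ x, x ∈ p.support := by
    intro x
    have := (reachable_iff_reflTransGen _ _).1 (hG.preconnected v x)
    induction this with
    | refl => exact p.start_mem_support
    | tail _ hyz ih => exact hclosed _ ih _ hyz
  refine Walk.IsHamiltonianCycle.length_eq
    (Walk.isHamiltonianCycle_iff_isCycle_and_support_count_tail_eq_one.2 ⟨hp, fun a => ?_⟩)
  refine List.count_eq_one_of_mem hp.support_nodup ?_
  rcases (Walk.mem_support_iff p).1 (hall a) with rfl | h
  · exact Walk.end_mem_tail_support hp.not_nil
  · exact h

lemma ncard_edgeSet_cycleGraph (k : ℕ) : (cycleGraph (k + 3)).edgeSet.ncard = k + 3 := by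
  have h := (cycleGraph (k + 3)).sum_degrees_eq_twice_card_edges
  simp only [cycleGraph_degree_three_le, Finset.sum_const, Finset.card_univ, Fintype.card_fin,
    smul_eq_mul] at h
  rw [← coe_edgeFinset, Set.ncard_coe_finset]
  lia

lemma isUnicyclic_cycleGraph (k : ℕ) : IsUnicyclic (cycleGraph (k + 3)) :=
  ⟨cycleGraph_connected, by rw [ncard_edgeSet_cycleGraph, Nat.card_fin]⟩

lemma girth_cycleGraph (k : ℕ) : (cycleGraph (k + 3)).girth = k + 3 := by
  have hna : ¬ (cycleGraph (k + 3)).IsAcyclic := fun h => h _ cycleGraph.isCycle_cycle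
  obtain ⟨a, w, hw, h⟩ := exists_girth_eq_length.2 hna
  rw [h, hw.length_eq_card_of_degree_eq_two cycleGraph_connected
    (fun _ => cycleGraph_degree_three_le), Fintype.card_fin]

/-- A unicyclic graph whose girth is its number of vertices is a cycle. -/
lemma _root_.IsUnicyclic.iso_cycleGraph [Finite V] (hG : IsUnicyclic G) {k : ℕ}
    (hcard : Nat.card V = k + 3) (hgirth : G.girth = k + 3) :
    Nonempty (cycleGraph (k + 3) ≃g G) := by
  have hna : ¬ G.IsAcyclic := fun h => by
    rw [h.girth_eq_zero] at hgirth
    lia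
  obtain ⟨a, w, hw, h⟩ := exists_girth_eq_length.2 hna
  obtain ⟨f⟩ := (cycleGraph_isContained_iff (G := G) (n := k + 3) (by lia)).2
    ⟨a, w, hw, by rw [← h, hgirth]⟩
  have hbij : Function.Bijective f :=
    f.injective.bijective_of_nat_card_le (by rw [hcard, Nat.card_fin])
  let e := Equiv.ofBijective f hbij
  have hle : cycleGraph (k + 3) ≤ G.comap e := fun x y hxy => f.toHom.map_adj hxy
  have hcomap : (G.comap e).edgeSet.ncard = k + 3 := by
    rw [← Nat.card_coe_set_eq, Nat.card_congr (Iso.comap e G).mapEdgeSet, Nat.card_coe_set_eq,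
      hG.2, hcard]
  -- The cycle lies inside the transported graph and both have `k + 3` edges.
  have heq : cycleGraph (k + 3) = G.comap e := by
    rw [← edgeSet_inj]
    refine Set.eq_of_subset_of_ncard_le (edgeSet_mono hle) ?_ (Set.toFinite _)
    rw [hcomap, ncard_edgeSet_cycleGraph]
  exact ⟨heq ▸ Iso.comap e G⟩

/-- A unicyclic graph with more vertices than its girth has a vertex of degree one. -/
lemma _root_.IsUnicyclic.exists_leaf [Finite V] (hG : IsUnicyclic G) (h3 : 3 ≤ G.girth)
    (hlt : G.girth < Nat.card V) : ∃ v, ∃! u, G.Adj v u := by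
  classical
  have := Fintype.ofFinite V
  -- Without leaves all degrees are at least `2`; the degree sum `2n` makes them equal to `2`, so a
  -- shortest cycle is Hamiltonian, against `girth < n`.
  by_contra! hno
  rw [Nat.card_eq_fintype_card] at hlt
  have hnt : Nontrivial V := Fintype.one_lt_card_iff_nontrivial.1 (by lia)
  have hge : ∀ v, 2 ≤ G.degree v := by
    intro v
    have h1 := hG.1.preconnected.degree_pos_of_nontrivial v
    have h2 : G.degree v ≠ 1 := fun h => hno v (degree_eq_one_iff_existsUnique_adj.1 h)
    lia
  have hsum := G.sum_degrees_eq_twice_card_edges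
  have hcard : G.edgeFinset.card = Fintype.card V := by
    rw [← Nat.card_eq_fintype_card, ← hG.2, ← coe_edgeFinset, Set.ncard_coe_finset]
  have hdeg : ∀ v, G.degree v = 2 := by
    have hs : ∑ _v : V, 2 = ∑ v, G.degree v := by
      rw [hsum, hcard, Finset.sum_const, Finset.card_univ, smul_eq_mul, mul_comm]
    exact fun v => ((Finset.sum_eq_sum_iff_of_le fun v _ => hge v).1 hs v (Finset.mem_univ v)).symm
  have hna : ¬ G.IsAcyclic := fun h => by
    rw [h.girth_eq_zero] at h3
    lia
  obtain ⟨a, w, hw, h⟩ := exists_girth_eq_length.2 hna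
  have := hw.length_eq_card_of_degree_eq_two hG.1 hdeg
  lia

end cycle

/-! ### Pineapple graphs and their counts -/

section pineapple

/-- The definition still makes sense for `g = n`, which provides the base case `m = 0` of the
inductions. -/
lemma pineappleGraph_self (k : ℕ) : pineappleGraph (k + 3) (k + 3) = cycleGraph (k + 3) := by
  ext a b
  rcases eq_or_ne a b with rfl | hab
  · exact iff_of_false (SimpleGraph.irrefl _) (SimpleGraph.irrefl _)
  have ha := a.isLt
  have hb := b.isLt
  rw [cycleGraph_adj', pineappleGraph, fromRel_adj, ne_eq, Fin.ext_iff]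
  rcases hab.lt_or_gt with h | h
  · rw [Fin.coe_sub_iff_lt.2 h, Fin.coe_sub_iff_le.2 h.le]
    rw [Fin.lt_def] at h
    lia
  · rw [Fin.coe_sub_iff_lt.2 h, Fin.coe_sub_iff_le.2 h.le]
    rw [Fin.lt_def] at h
    lia

/-- A pineapple graph arises from the next smaller one by attaching a pendant vertex. -/
def addLeafPineappleIso {n g : ℕ} (h0 : 0 < n) (hgn : g ≤ n) :
    addLeaf (pineappleGraph n g) ⟨0, h0⟩ ≃g pineappleGraph (n + 1) g where
  toEquiv := finSuccEquivLast.symm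
  map_rel_iff' := by
    rintro (_ | a) (_ | b)
    · exact iff_of_false (SimpleGraph.irrefl _) (SimpleGraph.irrefl _)
    · simp only [finSuccEquivLast_symm_none, finSuccEquivLast_symm_some, pineappleGraph,
        fromRel_adj, addLeaf_none_some, Fin.ext_iff, ne_eq, Fin.val_last, Fin.val_castSucc]
      lia
    · simp only [finSuccEquivLast_symm_none, finSuccEquivLast_symm_some, pineappleGraph,
        fromRel_adj, addLeaf_some_none, Fin.ext_iff, ne_eq, Fin.val_last, Fin.val_castSucc]
      lia
    · simp only [finSuccEquivLast_symm_some, pineappleGraph, fromRel_adj,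
        addLeaf_some_some, Fin.ext_iff, ne_eq, Fin.val_castSucc]

lemma addLeafPineappleIso_some {n g : ℕ} (h0 : 0 < n) (hgn : g ≤ n) (a : Fin n) :
    addLeafPineappleIso h0 hgn (some a) = a.castSucc := by
  simp [addLeafPineappleIso]

end pineapple

/-- Rotations of the cycle. -/
def zmodCycleRotate (k : ℕ) (c : ZMod (k + 3)) : zmodCycle k ≃g zmodCycle k where
  toEquiv := Equiv.addRight c
  map_rel_iff' := by
    intro a b
    simp [zmodCycle, add_right_comm _ c]

/-- By rotation, any vertex of the cycle can serve as the centre. -/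
lemma exists_iso_pineapple_self (k : ℕ) (w : ZMod (k + 3)) :
    ∃ φ : zmodCycle k ≃g pineappleGraph (k + 3) (k + 3), φ w = ⟨0, by lia⟩ := by
  rw [pineappleGraph_self]
  refine ⟨(zmodCycleRotate k (-w)).trans (zmodCycleIso k), ?_⟩
  change w + -w = (0 : ZMod (k + 3))
  exact add_neg_cancel w

/-- The number of connected subgraphs of a pineapple graph containing the centre. -/
lemma coreIndexAt_pineapple_center (k m : ℕ) :
    (pineappleGraph (k + 3 + m) (k + 3)).coreIndexAt {⟨0, by lia⟩} =
      2 ^ m * ((k + 4).choose 2 + 1) := by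
  induction m with
  | zero =>
    obtain ⟨φ, hφ⟩ := exists_iso_pineapple_self k 0
    have := coreIndexAt_singleton_iso φ 0
    rw [hφ, coreIndexAt_zmodCycle_singleton] at this
    simpa using this.symm
  | succ m ih =>
    have := coreIndexAt_singleton_iso
      (addLeafPineappleIso (n := k + 3 + m) (g := k + 3) (by lia) (by lia))
      (some ⟨0, by lia⟩)
    rw [addLeafPineappleIso_some, coreIndexAt_addLeaf_singleton_some, Set.pair_eq_singleton,
      ih] at this
    exact this.symm.trans (by ring)

lemma coreIndex_pineapple_succ (k m : ℕ) :
    coreIndex (pineappleGraph (k + 3 + (m + 1)) (k + 3)) =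
      coreIndex (pineappleGraph (k + 3 + m) (k + 3)) +
        (2 ^ m * ((k + 4).choose 2 + 1) + 1) := by
  have := coreIndex_iso
    (addLeafPineappleIso (n := k + 3 + m) (g := k + 3) (by lia) (by lia))
  rw [coreIndex_eq_coreIndexAt (addLeaf _ _), coreIndexAt_addLeaf_empty,
    ← coreIndex_eq_coreIndexAt, coreIndexAt_pineapple_center] at this
  exact this.symm

/-- The geometric sum of the increments, with one term moved to the left to avoid truncated
subtraction. -/
lemma coreIndex_pineapple (k m : ℕ) :
    coreIndex (pineappleGraph (k + 3 + m) (k + 3)) + ((k + 4).choose 2 + 1) =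
      (k + 3) ^ 2 + 1 + m + 2 ^ m * ((k + 4).choose 2 + 1) := by
  induction m with
  | zero =>
    obtain ⟨φ, -⟩ := exists_iso_pineapple_self k 0
    have := coreIndex_iso φ
    rw [coreIndex_eq_coreIndexAt (zmodCycle k), coreIndexAt_zmodCycle_empty] at this
    simp [← this]
  | succ m ih =>
    rw [coreIndex_pineapple_succ, pow_succ 2 m]
    linarith

lemma isUnicyclic_pineapple (k m : ℕ) : IsUnicyclic (pineappleGraph (k + 3 + m) (k + 3)) := by
  induction m with
  | zero =>
    rw [add_zero, pineappleGraph_self]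
    exact isUnicyclic_cycleGraph k
  | succ m ih =>
    exact (isUnicyclic_iso (addLeafPineappleIso (n := k + 3 + m) (g := k + 3)
      (by lia) (by lia))).1 (isUnicyclic_addLeaf.2 ih)

lemma girth_pineapple (k m : ℕ) : (pineappleGraph (k + 3 + m) (k + 3)).girth = k + 3 := by
  induction m with
  | zero =>
    rw [add_zero, pineappleGraph_self]
    exact girth_cycleGraph k
  | succ m ih =>
    exact (addLeafPineappleIso (n := k + 3 + m) (g := k + 3)
      (by lia) (by lia)).girth_eq.symm.trans (girth_addLeaf.trans ih)

-- The extremal induction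

universe u

/-- Attaching a pendant vertex to the centre of a pineapple graph. -/
def addLeafIsoPineapple {W : Type u} {H : SimpleGraph W} {u : W} {k m : ℕ}
    (φ : H ≃g pineappleGraph (k + 3 + m) (k + 3)) (hφ : φ u = ⟨0, by lia⟩) :
    addLeaf H u ≃g pineappleGraph (k + 3 + (m + 1)) (k + 3) :=
  (addLeafIso φ hφ).trans
    (addLeafPineappleIso (n := k + 3 + m) (g := k + 3) (by lia) (by lia))

lemma addLeafIsoPineapple_some {W : Type u} {H : SimpleGraph W} {u : W} {k m : ℕ}
    (φ : H ≃g pineappleGraph (k + 3 + m) (k + 3)) (hφ : φ u = ⟨0, by lia⟩) :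
    addLeafIsoPineapple φ hφ (some u) = ⟨0, by lia⟩ := by
  change addLeafPineappleIso (n := k + 3 + m) (g := k + 3) (by lia) (by lia) (some (φ u)) = _
  rw [hφ, addLeafPineappleIso_some]
  rfl

/-- A unicyclic graph with more vertices than its girth arises from a smaller unicyclic graph of the
same girth by attaching a pendant vertex. -/
lemma _root_.IsUnicyclic.exists_addLeaf {V : Type u} [Finite V] {G : SimpleGraph V}
    (hG : IsUnicyclic G) {k m : ℕ} (hgirth : G.girth = k + 3)
    (hcard : Nat.card V = k + 3 + (m + 1)) :
    ∃ (W : Type u) (_ : Finite W) (H : SimpleGraph W) (u : W), IsUnicyclic H ∧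
      H.girth = k + 3 ∧ Nat.card W = k + 3 + m ∧ Nonempty (G ≃g addLeaf H u) := by
  obtain ⟨v, hv⟩ := hG.exists_leaf (by lia) (by lia)
  obtain ⟨H, u, ⟨φ⟩⟩ := exists_iso_addLeaf hv
  refine ⟨_, inferInstance, H, u, isUnicyclic_addLeaf.1 ((isUnicyclic_iso φ).1 hG), ?_, ?_, ⟨φ⟩⟩
  · rw [← hgirth, φ.girth_eq, girth_addLeaf]
  · have := Nat.card_congr φ.toEquiv
    rw [Finite.card_option] at this
    lia

/-- The number of connected subgraphs through a given vertex is largest for the centre of the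
pineapple graph, and only there. -/
lemma _root_.IsUnicyclic.coreIndexAt_singleton_le {k : ℕ} (m : ℕ) {V : Type u} [Finite V]
    {G : SimpleGraph V} (hG : IsUnicyclic G) (hgirth : G.girth = k + 3)
    (hcard : Nat.card V = k + 3 + m) (w : V) :
    G.coreIndexAt {w} ≤ 2 ^ m * ((k + 4).choose 2 + 1) ∧
      (G.coreIndexAt {w} = 2 ^ m * ((k + 4).choose 2 + 1) →
        ∃ φ : G ≃g pineappleGraph (k + 3 + m) (k + 3), φ w = ⟨0, by lia⟩) := by
  induction m generalizing V with
  | zero =>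
    obtain ⟨ψ⟩ := hG.iso_cycleGraph hcard hgirth
    let χ : G ≃g zmodCycle k := ψ.symm.trans (zmodCycleIso k).symm
    rw [coreIndexAt_singleton_iso χ w, coreIndexAt_zmodCycle_singleton]
    refine ⟨by simp, fun _ => ?_⟩
    obtain ⟨φ, hφ⟩ := exists_iso_pineapple_self k (χ w)
    exact ⟨χ.trans φ, hφ⟩
  | succ m ih =>
    obtain ⟨W, _, H, u, hH, hHg, hHc, ⟨ψ⟩⟩ := hG.exists_addLeaf hgirth hcard
    have hnt : Nontrivial W := Finite.one_lt_card_iff_nontrivial.1 (by lia)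
    have h1 := one_lt_coreIndexAt_singleton hH.1 u
    obtain ⟨hle, -⟩ := ih hH hHg hHc u
    rw [coreIndexAt_singleton_iso ψ w, pow_succ]
    -- Only a leaf attached at `w` itself can double the count: if `w` is the leaf, `h1` makes the
    -- bound strict, and if `w ≠ u`, `coreIndexAt_insert_lt` does.
    rcases hw : ψ w with _ | x
    · rw [coreIndexAt_addLeaf_none]
      exact ⟨by lia, fun h => by lia⟩
    · rw [coreIndexAt_addLeaf_singleton_some]
      obtain ⟨hlex, hex⟩ := ih hH hHg hHc x
      rcases eq_or_ne u x with rfl | hne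
      · rw [Set.pair_eq_singleton]
        refine ⟨by lia, fun h => ?_⟩
        obtain ⟨φ, hφ⟩ := hex (by lia)
        refine ⟨ψ.trans (addLeafIsoPineapple φ hφ), ?_⟩
        change addLeafIsoPineapple φ hφ (ψ w) = _
        rw [hw, addLeafIsoPineapple_some]
      · have := H.coreIndexAt_insert_lt hne
        exact ⟨by lia, fun h => by lia⟩

/-- Pineapple graphs maximize the number of connected subgraphs. -/
lemma _root_.IsUnicyclic.coreIndex_le {k m : ℕ} {V : Type u} [Finite V] {G : SimpleGraph V}
    (hG : IsUnicyclic G) (hgirth : G.girth = k + 3) (hcard : Nat.card V = k + 3 + m) :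
    coreIndex G ≤ coreIndex (pineappleGraph (k + 3 + m) (k + 3)) ∧
      (coreIndex G = coreIndex (pineappleGraph (k + 3 + m) (k + 3)) →
        Nonempty (G ≃g pineappleGraph (k + 3 + m) (k + 3))) := by
  induction m generalizing V with
  | zero =>
    obtain ⟨ψ⟩ := hG.iso_cycleGraph hcard hgirth
    obtain ⟨φ, -⟩ := exists_iso_pineapple_self k 0
    let χ := (ψ.symm.trans (zmodCycleIso k).symm).trans φ
    exact ⟨(coreIndex_iso χ).le, fun _ => ⟨χ⟩⟩
  | succ m ih =>
    obtain ⟨W, _, H, u, hH, hHg, hHc, ⟨ψ⟩⟩ := hG.exists_addLeaf hgirth hcard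
    obtain ⟨hle, -⟩ := ih hH hHg hHc
    obtain ⟨hleu, heq⟩ := hH.coreIndexAt_singleton_le m hHg hHc u
    rw [coreIndex_iso ψ, coreIndex_eq_coreIndexAt, coreIndexAt_addLeaf_empty,
      ← coreIndex_eq_coreIndexAt, coreIndex_pineapple_succ]
    refine ⟨by lia, fun h => ?_⟩
    -- Equality of the sums forces `F_H(u)` to be maximal, which already makes `H` a pineapple (or
    -- the cycle) with centre `u`.
    obtain ⟨φ, hφ⟩ := heq (by lia)
    exact ⟨ψ.trans (addLeafIsoPineapple φ hφ)⟩

end SimpleGraph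

open SimpleGraph in
theorem theorem4p3 (n g : ℕ) (hg : 3 ≤ g) (hgn : g < n) :
    (IsUnicyclic (pineappleGraph n g) ∧ (pineappleGraph n g).girth = g) ∧
    (∀ (V : Type*) [Fintype V] (G : SimpleGraph V),
      Fintype.card V = n → IsUnicyclic G → G.girth = g →
        coreIndex G ≤ coreIndex (pineappleGraph n g) ∧
        (coreIndex G = coreIndex (pineappleGraph n g) ↔
          Nonempty (G ≃g pineappleGraph n g))) ∧
    (coreIndex (pineappleGraph n g) : ℤ) =
      (n : ℤ) + (g : ℤ) ^ 2 - (g : ℤ) + 1 +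
        ((2 : ℤ) ^ (n - g) - 1) * (2 * (g : ℤ) + ((g - 1).choose 2 : ℤ)) := by
  obtain ⟨k, rfl⟩ : ∃ k, g = k + 3 := ⟨g - 3, by lia⟩
  obtain ⟨m, rfl⟩ : ∃ m, n = k + 3 + m := ⟨n - (k + 3), by lia⟩
  refine ⟨⟨isUnicyclic_pineapple k m, girth_pineapple k m⟩, fun V _ G hcard hG hgirth => ?_, ?_⟩
  · obtain ⟨hle, heq⟩ := hG.coreIndex_le hgirth (by rw [Nat.card_eq_fintype_card, hcard])
    exact ⟨hle, heq, fun ⟨φ⟩ => coreIndex_iso φ⟩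
  · have h := coreIndex_pineapple k m
    -- Pascal's rule twice, with `g = k + 3`: `C(g+1, 2) = g + (g-1) + C(g-1, 2)`.
    have hC : (k + 4).choose 2 + 1 = 2 * (k + 3) + (k + 2).choose 2 := by
      rw [Nat.choose_succ_succ' (k + 3) 1, Nat.choose_succ_succ' (k + 2) 1,
        Nat.choose_one_right, Nat.choose_one_right]
      lia
    rw [hC] at h
    have h' : ((coreIndex (pineappleGraph (k + 3 + m) (k + 3)) : ℕ) : ℤ) +
        (2 * (k + 3) + (k + 2).choose 2) =
        (k + 3) ^ 2 + 1 + m + 2 ^ m * (2 * (k + 3) + (k + 2).choose 2) := by exact_mod_cast h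
    rw [Nat.add_sub_cancel_left, show k + 3 - 1 = k + 2 by lia]
    push_cast
    linear_combination h'
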